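/- **Setting.** Let $X$ be $\mathbf S^2\times\mathbf R$ or $\mathbf H^2\times\mathbf R$, in the model with centre $E_0=(0,0,0)$. For $\mathbf S^2\times\mathbf R$ the points are $\mathbf R^3\setminus\{0\}$; put $\langle x,y\rangle=x_0y_0+x_1y_1+x_2y_2$, $\kappa=1$, $(\mathrm{cs},w)=(\cos,\sin)$. For $\mathbf H^2\times\mathbf R$ put $\langle x,y\rangle=x_0y_0-x_1y_1-x_2y_2$, $\kappa=-1$, $(\mathrm{cs},w)=(\cosh,\sinh)$; the points are the $x\in\mathbf R^3$ with $\langle x,x\rangle>0$, $x_0>0$. The base plane is $\langle x,x\rangle=1$, the fibres are the open rays from $E_0$. The complete geodesics, parametrized by arc length, are $$\gamma(\tau)=e^{h+\tau\sin v}\big(\mathrm{cs}(\tau\cos v)\,p+w(\tau\cos v)\,q\big),\qquad h\in\mathbf R,\ -\tfrac{\pi}{2}\le v\le\tfrac{\pi}{2},$$ with $p\in X$, $\langle p,p\rangle=1$, $\langle p,q\rangle=0$, $\langle q,q\rangle=\kappa$; $\gamma$ is a fibre if and only if $\cos v=0$. The distance $d(P,Q)$ is the least length of a geodesic arc from $P$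 to $Q$, and the side $PQ$ (geodesic segment) is formed by the geodesic arcs of that length. **Triangle surface.** For $A_0,A_1,A_2\in X$ and $\lambda_1,\lambda_2\ge 0$, not both $0$, let $\mathcal C(\lambda_1,\lambda_2)=\{Y\in X: d(A_0,Y)=\lambda_1 d(Y,A_1),\ d(A_2,Y)=\lambda_2 d(Y,A_0)\}$ if $\lambda_1,\lambda_2>0$, $\mathcal C(0,\lambda_2)=\{A_0\}$, and $\mathcal C(\lambda_1,0)=\{A_2\}$. The surface $\mathcal S_{A_0A_1A_2}$ consists of all points of the sets $\mathcal C(\lambda_1,\lambda_2)$ at which $d(\cdot,A_0)$ attains its minimum on $\mathcal C(\lambda_1,\lambda_2)$, together with $A_1$ (the limiting case $\lambda_1=\infty$). For $P_1,P_2\in X$, the curve $P_1P_2$ in this surface is the image in $\mathcal S_{A_0A_1A_2}$ of a complete geodesic through $P_1$ and $P_2$ under the central projection from $E_0$ (along the fibres); where the geodesic is not unique, any may be taken. **Simple ratio.** Let $A,P,B$ be distinct points of a geodesic that is not a fibre, with parameter $v$; for $X=\mathbf S^2\times\mathbf R$ assume that the arcs of this geodesic between any two of them are shorter than a semicircle (length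 times $\cos v$ is less than $\pi$). Put $$s_g(A,P,B)=\pm\,\frac{w(d(A,P)\cos v)}{w(d(P,B)\cos v)},$$ with sign $+$ if $P$ lies between $A$ and $B$ (on the segment $AB$), and $-$ otherwise. **Theorem 4.7 (Ceva's theorem for geodesic triangles in general location).** Let $A_0,A_1,A_2\in X$ be such that no Euclidean plane through $E_0$ contains all three. Let $T\in\mathcal S_{A_0A_1A_2}$ be a point not on any of the sides $A_0A_1$, $A_1A_2$, $A_2A_0$. Let $g_{01}$, $g_{12}$, $g_{20}$ be geodesics through $A_0,A_1$, through $A_1,A_2$ and through $A_2,A_0$, respectively. Suppose that the curves $A_0T$, $A_1T$, $A_2T$ in $\mathcal S_{A_0A_1A_2}$ meet $g_{12}$, $g_{20}$, $g_{01}$ in $Q$, $R$, $P$, respectively, and that the triples $(A_0,P,A_1)$, $(A_1,Q,A_2)$, $(A_2,R,A_0)$ on $g_{01}$, $g_{12}$, $g_{20}$ have simple ratios, in the sense that they satisfy the conditions above. Then $$s_g(A_0,P,A_1)\,s_g(A_1,Q,A_2)\,s_g(A_2,R,A_0)=1.$$ -/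

import Mathlib

/-- The two product geometries `S² × ℝ` and `H² × ℝ`. -/
inductive ProductGeometry where
  | s2r
  | h2r

namespace ProductGeometry

/-- The sign of the curvature of the base plane: `1` for `S²`, `-1` for `H²`. -/
def sign : ProductGeometry → ℝ
  | s2r => 1
  | h2r => -1

/-- The bilinear form `x₀ y₀ ± x₁ y₁ ± x₂ y₂` on the affine coordinates of the projective model
(the point `(1, x₀, x₁, x₂)`; the centre `E₀` of the model is the origin). -/
def form (X : ProductGeometry) (x y : Fin 3 → ℝ) : ℝ :=
  x 0 * y 0 + X.sign * (x 1 * y 1 + x 2 * y 2)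

/-- The points of the model: `ℝ³ ∖ {0}` for `S² × ℝ`, and the open half cone
`x₀² - x₁² - x₂² > 0`, `x₀ > 0` for `H² × ℝ`. The fibres are the open rays from the origin, the
base plane is `form x x = 1`, and the fibre coordinate is `t = log √(form x x)`. -/
def space : ProductGeometry → Set (Fin 3 → ℝ)
  | s2r => {x | x ≠ 0}
  | h2r => {x | 0 < h2r.form x x ∧ 0 < x 0}

/-- `cos` or `cosh`. -/
noncomputable def cs : ProductGeometry → ℝ → ℝ
  | s2r => Real.cos
  | h2r => Real.cosh

/-- `sin` or `sinh`; this is also the weight function `w` of the simple ratio. -/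
noncomputable def sn : ProductGeometry → ℝ → ℝ
  | s2r => Real.sin
  | h2r => Real.sinh

/-- A complete geodesic parametrized by arc length. It starts over the point `base` of the base
plane at height (fibre coordinate) `height`, its horizontal direction is the unit tangent vector
`dir`, and `v` is its angle with the base plane. For `base = (1, 0, 0)`,
`dir = (0, cos u, sin u)`, `height = 0` this is the geodesic with parameters `u`, `v` starting
at `(1, 1, 0, 0)`; isometries carry these to all the others. -/
structure Geodesic (X : ProductGeometry) where
  base : Fin 3 → ℝ
  base_mem : base ∈ X.space
  base_unit : X.form base base = 1
  dir : Fin 3 → ℝ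
  dir_tangent : X.form base dir = 0
  dir_unit : X.form dir dir = X.sign
  height : ℝ
  v : ℝ
  v_mem : v ∈ Set.Icc (-(Real.pi / 2)) (Real.pi / 2)

/-- The point of the geodesic with arc length parameter `τ`. -/
noncomputable def Geodesic.point {X : ProductGeometry} (g : X.Geodesic) (τ : ℝ) : Fin 3 → ℝ :=
  Real.exp (g.height + τ * Real.sin g.v) •
    (X.cs (τ * Real.cos g.v) • g.base + X.sn (τ * Real.cos g.v) • g.dir)

/-- The distance of two points: the least length of a geodesic arc from one to the other. -/
noncomputable def gdist (X : ProductGeometry) (P Q : Fin 3 → ℝ) : ℝ :=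
  sInf {l : ℝ | 0 ≤ l ∧ ∃ g : X.Geodesic, g.point 0 = P ∧ g.point l = Q}

/-- The points of the (shortest) geodesic segment from `P` to `Q`. -/
def geodesicSegment (X : ProductGeometry) (P Q : Fin 3 → ℝ) : Set (Fin 3 → ℝ) :=
  {Y | ∃ g : X.Geodesic, g.point 0 = P ∧ g.point (X.gdist P Q) = Q ∧
    ∃ s ∈ Set.Icc 0 (X.gdist P Q), g.point s = Y}

/-- The Apollonius surface of `P₁`, `P₂` with ratio `r ∈ [0, ∞)`. -/
def apollonius (X : ProductGeometry) (P₁ P₂ : Fin 3 → ℝ) (r : ℝ) : Set (Fin 3 → ℝ) :=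
  {Y | Y ∈ X.space ∧ X.gdist P₁ Y = r * X.gdist Y P₂}

open Classical in
/-- The set `C(r₁, r₂)`: the intersection of the Apollonius surfaces of `A₀`, `A₁` with ratio `r₁`
and of `A₂`, `A₀` with ratio `r₂`, where by convention it is `A₀` for `r₁ = 0` and `A₂` for
`r₂ = 0`. -/
noncomputable def apolloniusCurve (X : ProductGeometry) (A₀ A₁ A₂ : Fin 3 → ℝ) (r₁ r₂ : ℝ) :
    Set (Fin 3 → ℝ) :=
  if r₁ = 0 then {A₀} else if r₂ = 0 then {A₂}
  else X.apollonius A₀ A₁ r₁ ∩ X.apollonius A₂ A₀ r₂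

/-- The surface of the geodesic triangle `A₀A₁A₂`: the points of the sets `C(r₁, r₂)` that are
nearest to `A₀`, together with the vertex `A₁`, which belongs to the limiting ratio `r₁ = ∞`. -/
def triangleSurface (X : ProductGeometry) (A₀ A₁ A₂ : Fin 3 → ℝ) : Set (Fin 3 → ℝ) :=
  {A₁} ∪ {P | ∃ r₁ r₂ : ℝ, 0 ≤ r₁ ∧ 0 ≤ r₂ ∧ 0 < r₁ ^ 2 + r₂ ^ 2 ∧
    P ∈ X.apolloniusCurve A₀ A₁ A₂ r₁ r₂ ∧
    ∀ Q ∈ X.apolloniusCurve A₀ A₁ A₂ r₁ r₂, X.gdist P A₀ ≤ X.gdist Q A₀}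

/-- The connecting curve of `P₁`, `P₂` in the surface `S`: the image in `S` of a complete geodesic
through `P₁` and `P₂` under the central projection from the origin `E₀`. -/
def connectingCurve (X : ProductGeometry) (S : Set (Fin 3 → ℝ)) (P₁ P₂ : Fin 3 → ℝ) :
    Set (Fin 3 → ℝ) :=
  {Y | Y ∈ S ∧ ∃ g : X.Geodesic, (∃ a, g.point a = P₁) ∧ (∃ b, g.point b = P₂) ∧
    ∃ τ c : ℝ, 0 < c ∧ Y = c • g.point τ}

/-- The three points lie in no Euclidean plane through the origin `E₀`. -/
def GeneralLocation (A₀ A₁ A₂ : Fin 3 → ℝ) : Prop :=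
  ¬ ∃ n : Fin 3 → ℝ, n ≠ 0 ∧ n ⬝ᵥ A₀ = 0 ∧ n ⬝ᵥ A₁ = 0 ∧ n ⬝ᵥ A₂ = 0

/-- The arc of `g` between the parameters `a`, `b` is shorter than a semicircle, i.e. its
projection to the base sphere is; no condition for `H² × ℝ`. -/
def ShortArc : (X : ProductGeometry) → X.Geodesic → ℝ → ℝ → Prop
  | s2r, g, a, b => |a - b| * Real.cos g.v < Real.pi
  | h2r, _, _, _ => True

/-- `A`, `P`, `B` are distinct points of the geodesic `g`, which is not a fibre, and the arcs of
`g` between them are shorter than a semicircle: the triples that have a simple ratio. -/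
def HasSimpleRatio (X : ProductGeometry) (g : X.Geodesic) (A P B : Fin 3 → ℝ) : Prop :=
  Real.cos g.v ≠ 0 ∧ A ≠ P ∧ P ≠ B ∧ A ≠ B ∧
    ∃ a p b : ℝ, g.point a = A ∧ g.point p = P ∧ g.point b = B ∧
      X.ShortArc g a p ∧ X.ShortArc g p b ∧ X.ShortArc g a b

open Classical in
/-- The simple ratio `s_g(A, P, B)` of three points of the geodesic `g`. -/
noncomputable def simpleRatio (X : ProductGeometry) (g : X.Geodesic) (A P B : Fin 3 → ℝ) : ℝ :=
  if P ∈ X.geodesicSegment A B then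
    X.sn (X.gdist A P * Real.cos g.v) / X.sn (X.gdist P B * Real.cos g.v)
  else
    -(X.sn (X.gdist A P * Real.cos g.v) / X.sn (X.gdist P B * Real.cos g.v))

end ProductGeometry

namespace ProductGeometry

variable {X : ProductGeometry}

/-! ### Trigonometry -/

/-! Central projection from `E₀` turns the theorem into linear algebra. A geodesic projects into a
plane through `E₀`, so each connecting curve through a vertex and `T` lies in such a plane, whatever
the surface is (`det₃_eq_zero_of_mem_connectingCurve`). The simple ratio is linear too: projected to
the base plane, `P` is up to a factor `x • A' + y • B'`, where `A'`, `B'` are the projected end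
points, and `s_g(A, P, B) = y / x` (`HasSimpleRatio.exists_coefficients`). Ceva's theorem for three
planes through a common line `E₀T` then follows from Cramer's rule (`ceva_of_det₃`). The metric work
lies in the ratio: on arcs below a semicircle, distance is the parameter difference (`gdist_point`)
and the segment is the parameter interval (`point_mem_geodesicSegment_iff`), so the sign convention
makes `s_g` a quotient of signed sines. -/

lemma cs_sub (X : ProductGeometry) (x y : ℝ) :
    X.cs (x - y) = X.cs x * X.cs y + X.sign * (X.sn x * X.sn y) := by
  cases X
  · simp [cs, sn, sign, Real.cos_sub]
  · simp only [cs, sn, sign, Real.cosh_sub]; ring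

lemma sn_neg (X : ProductGeometry) (x : ℝ) : X.sn (-x) = -X.sn x := by
  cases X <;> simp [sn]

lemma cs_neg (X : ProductGeometry) (x : ℝ) : X.cs (-x) = X.cs x := by
  cases X <;> simp [cs]

lemma sn_zero (X : ProductGeometry) : X.sn 0 = 0 := by cases X <;> simp [sn]

lemma cs_zero (X : ProductGeometry) : X.cs 0 = 1 := by cases X <;> simp [cs]

lemma sn_sub (X : ProductGeometry) (x y : ℝ) :
    X.sn (x - y) = X.sn x * X.cs y - X.cs x * X.sn y := by
  cases X
  · simp [cs, sn, Real.sin_sub]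
  · simp only [cs, sn, Real.sinh_sub]

lemma sn_add (X : ProductGeometry) (x y : ℝ) :
    X.sn (x + y) = X.sn x * X.cs y + X.cs x * X.sn y := by
  have := X.sn_sub x (-y)
  rw [sub_neg_eq_add, sn_neg, cs_neg] at this
  linarith

lemma cs_add (X : ProductGeometry) (x y : ℝ) :
    X.cs (x + y) = X.cs x * X.cs y - X.sign * (X.sn x * X.sn y) := by
  have := X.cs_sub x (-y)
  rw [sub_neg_eq_add, sn_neg, cs_neg] at this
  linarith

lemma cs_sq_add (X : ProductGeometry) (x : ℝ) :
    X.cs x * X.cs x + X.sign * (X.sn x * X.sn x) = 1 := by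
  rw [← cs_sub, sub_self, cs_zero]

/-- The angles less than a semicircle; no condition for `H² × ℝ`. -/
def SmallAngle : ProductGeometry → ℝ → Prop
  | s2r, x => |x| < Real.pi
  | h2r, _ => True

lemma SmallAngle.mono {x y : ℝ} (h : X.SmallAngle x) (hxy : |y| ≤ |x|) : X.SmallAngle y := by
  cases X
  · exact lt_of_le_of_lt hxy h
  · trivial

lemma SmallAngle.sn_ne_zero {x : ℝ} (h : X.SmallAngle x) (hx : x ≠ 0) : X.sn x ≠ 0 := by
  cases X
  · have h' := abs_lt.1 h
    exact fun h0 => hx ((Real.sin_eq_zero_iff_of_lt_of_lt h'.1 h'.2).1 h0)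
  · simpa [sn] using hx

lemma SmallAngle.eq_of_cs_sub_eq_one {x y : ℝ} (hx : X.SmallAngle x) (hy : X.SmallAngle y)
    (h : X.cs (x - y) = 1) : x = y := by
  refine sub_eq_zero.1 ?_
  cases X
  · have hx' := abs_lt.1 hx
    have hy' := abs_lt.1 hy
    exact (Real.cos_eq_one_iff_of_lt_of_lt (by linarith) (by linarith)).1 h
  · by_contra h0
    exact (Real.one_lt_cosh.2 h0).ne' h

/-- Monotonicity of `cos` on `[0, π]`, or of `cosh`; `y` itself need not be small, since competing
arcs may wind around the sphere. -/
lemma SmallAngle.abs_le_of_cs_eq {x y : ℝ} (hx : X.SmallAngle x) (hy : 0 ≤ y)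
    (h : X.cs y = X.cs x) : |x| ≤ y := by
  cases X
  · by_contra! hlt
    have := Real.cos_lt_cos_of_nonneg_of_le_pi hy (le_of_lt hx) hlt
    rw [Real.cos_abs] at this
    exact this.ne' h
  · rw [← abs_of_nonneg hy]
    exact Real.cosh_le_cosh.1 h.ge

/-! ### The form -/

lemma form_smul_smul (X : ProductGeometry) (a b : ℝ) (x y : Fin 3 → ℝ) :
    X.form (a • x) (b • y) = a * b * X.form x y := by
  simp only [form, Pi.smul_apply, smul_eq_mul]; ring

lemma form_combination (X : ProductGeometry) (a b c d : ℝ) (x y : Fin 3 → ℝ) :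
    X.form (a • x + b • y) (c • x + d • y) =
      a * c * X.form x x + (a * d + b * c) * X.form x y + b * d * X.form y y := by
  simp only [form, Pi.smul_apply, Pi.add_apply, smul_eq_mul]; ring

lemma ne_zero_of_form_self {x : Fin 3 → ℝ} (h : X.form x x = 1) : x ≠ 0 := by
  rintro rfl
  simp [form] at h

/-! ### Geodesics: projection, length and uniqueness of arcs -/

namespace Geodesic

/-- The projection of the geodesic to the base plane, parametrized by the angle. -/
noncomputable def shadow (g : X.Geodesic) (θ : ℝ) : Fin 3 → ℝ :=
  X.cs θ • g.base + X.sn θ • g.dir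

lemma point_eq (g : X.Geodesic) (τ : ℝ) :
    g.point τ = Real.exp (g.height + τ * Real.sin g.v) • g.shadow (τ * Real.cos g.v) := rfl

lemma form_shadow (g : X.Geodesic) (x y : ℝ) :
    X.form (g.shadow x) (g.shadow y) = X.cs (x - y) := by
  rw [shadow, shadow, form_combination, g.base_unit, g.dir_tangent, g.dir_unit, cs_sub]
  ring

lemma form_shadow_self (g : X.Geodesic) (x : ℝ) : X.form (g.shadow x) (g.shadow x) = 1 := by
  rw [form_shadow, sub_self, cs_zero]

lemma form_point (g : X.Geodesic) (s t : ℝ) :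
    X.form (g.point s) (g.point t) = Real.exp (g.height + s * Real.sin g.v) *
      Real.exp (g.height + t * Real.sin g.v) * X.cs ((s - t) * Real.cos g.v) := by
  rw [point_eq, point_eq, form_smul_smul, form_shadow, sub_mul]

lemma point_ne_zero (g : X.Geodesic) (t : ℝ) : g.point t ≠ 0 := by
  rw [point_eq]
  exact smul_ne_zero (Real.exp_ne_zero _) (ne_zero_of_form_self (g.form_shadow_self _))

lemma sqrt_form_point (g : X.Geodesic) (t : ℝ) :
    √(X.form (g.point t) (g.point t)) = Real.exp (g.height + t * Real.sin g.v) := by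
  rw [form_point, sub_self, zero_mul, cs_zero, mul_one, Real.sqrt_mul_self (Real.exp_nonneg _)]

lemma height_eq_of_point_eq {g g' : X.Geodesic} {s t : ℝ} (h : g.point s = g'.point t) :
    g.height + s * Real.sin g.v = g'.height + t * Real.sin g'.v := by
  apply Real.exp_injective
  rw [← sqrt_form_point, ← sqrt_form_point, h]

lemma shadow_eq_of_point_eq {g g' : X.Geodesic} {s t : ℝ} (h : g.point s = g'.point t) :
    g.shadow (s * Real.cos g.v) = g'.shadow (t * Real.cos g'.v) := by
  have h' := h
  rw [point_eq, point_eq, height_eq_of_point_eq h] at h'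
  exact smul_right_injective _ (Real.exp_ne_zero _) h'

lemma cos_v_nonneg (g : X.Geodesic) : 0 ≤ Real.cos g.v :=
  Real.cos_nonneg_of_mem_Icc g.v_mem

lemma shadow_mem (g : X.Geodesic) (x : ℝ) : g.shadow x ∈ X.space := by
  have h1 := g.form_shadow_self x
  cases X
  · exact ne_zero_of_form_self h1
  · refine ⟨by rw [h1]; norm_num, ?_⟩
    have hb := g.base_unit
    have ht := g.dir_tangent
    have hd := g.dir_unit
    have hpos : 0 < g.base 0 := g.base_mem.2
    simp only [form, sign] at hb ht hd
    -- Cauchy–Schwarz in the last two coordinates gives `dir₀² ≤ base₀² - 1`.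
    have hsq : g.dir 0 ^ 2 < g.base 0 ^ 2 := by
      have hc : (g.base 0 * g.dir 0) ^ 2 ≤ (g.base 0 ^ 2 - 1) * (g.dir 0 ^ 2 + 1) := by
        have e1 : g.base 0 * g.dir 0 = g.base 1 * g.dir 1 + g.base 2 * g.dir 2 := by linarith
        have e2 : g.base 0 ^ 2 - 1 = g.base 1 ^ 2 + g.base 2 ^ 2 := by linarith
        have e3 : g.dir 0 ^ 2 + 1 = g.dir 1 ^ 2 + g.dir 2 ^ 2 := by linarith
        rw [e1, e2, e3]
        nlinarith [sq_nonneg (g.base 1 * g.dir 2 - g.base 2 * g.dir 1)]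
      nlinarith
    have hlt : |g.dir 0| < g.base 0 := abs_lt_of_sq_lt_sq hsq hpos.le
    have hsc : |Real.sinh x| < Real.cosh x :=
      abs_lt_of_sq_lt_sq (by rw [Real.cosh_sq]; linarith) (Real.cosh_pos x).le
    have hprod : |Real.sinh x * g.dir 0| < Real.cosh x * g.base 0 := by
      rw [abs_mul]
      exact mul_lt_mul'' hsc hlt (abs_nonneg _) (abs_nonneg _)
    have := (abs_lt.1 hprod).1
    simp only [shadow, cs, sn, Pi.add_apply, Pi.smul_apply, smul_eq_mul]
    linarith

/-- The same geodesic with the point of parameter `a` as new starting point. -/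
noncomputable def shift (g : X.Geodesic) (a : ℝ) : X.Geodesic where
  base := g.shadow (a * Real.cos g.v)
  base_mem := g.shadow_mem _
  base_unit := g.form_shadow_self _
  dir := (-(X.sign * X.sn (a * Real.cos g.v))) • g.base + X.cs (a * Real.cos g.v) • g.dir
  dir_tangent := by
    rw [shadow, form_combination, g.base_unit, g.dir_tangent, g.dir_unit]
    ring
  dir_unit := by
    rw [form_combination, g.base_unit, g.dir_tangent, g.dir_unit]
    linear_combination X.sign * X.cs_sq_add (a * Real.cos g.v)
  height := g.height + a * Real.sin g.v
  v := g.v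
  v_mem := g.v_mem

lemma shift_point (g : X.Geodesic) (a τ : ℝ) : (g.shift a).point τ = g.point (a + τ) := by
  have h : g.height + a * Real.sin g.v + τ * Real.sin g.v =
    g.height + (a + τ) * Real.sin g.v := by ring
  ext i
  simp only [point, shift, shadow, Pi.smul_apply, Pi.add_apply, smul_eq_mul]
  rw [h, add_mul a τ (Real.cos g.v), cs_add, sn_add]
  ring

/-- The same geodesic traversed in the opposite direction. -/
noncomputable def reverse (g : X.Geodesic) : X.Geodesic where
  base := g.base
  base_mem := g.base_mem
  base_unit := g.base_unit
  dir := -g.dir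
  dir_tangent := by
    have := g.dir_tangent
    simp only [form, Pi.neg_apply] at this ⊢
    linear_combination -this
  dir_unit := by
    rw [← g.dir_unit]
    simp [form]
  height := g.height
  v := -g.v
  v_mem := ⟨by linarith [g.v_mem.2], by linarith [g.v_mem.1]⟩

lemma reverse_point (g : X.Geodesic) (τ : ℝ) : g.reverse.point τ = g.point (-τ) := by
  simp only [point, reverse, Real.sin_neg, Real.cos_neg, neg_mul, mul_neg, sn_neg, cs_neg, smul_neg,
    neg_smul]

/-- Any two parameters are joined by a parametrization starting at the first one. -/
lemma exists_reparam (g : X.Geodesic) (a b : ℝ) :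
    ∃ g' : X.Geodesic, Real.cos g'.v = Real.cos g.v ∧ ∃ ε : ℝ, ε * ε = 1 ∧ b = a + ε * |b - a| ∧
      ∀ τ, g'.point τ = g.point (a + ε * τ) := by
  rcases le_total a b with h | h
  · refine ⟨g.shift a, rfl, 1, by norm_num, ?_, fun τ => by rw [shift_point, one_mul]⟩
    rw [abs_of_nonneg (sub_nonneg.2 h)]; ring
  · refine ⟨(g.shift a).reverse, Real.cos_neg _, -1, by norm_num, ?_, fun τ => ?_⟩
    · rw [abs_of_nonpos (sub_nonpos.2 h)]; ring
    · rw [reverse_point, shift_point, neg_one_mul]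

/-- Pythagoras: the squared length is the squared height difference plus the squared angle. The end
points fix the former, and the latter is smallest for the arc below a semicircle. -/
lemma arc_le (g g' : X.Geodesic) {a b l : ℝ} (hab : X.SmallAngle ((a - b) * Real.cos g.v))
    (hl : 0 ≤ l) (h0 : g'.point 0 = g.point a) (h1 : g'.point l = g.point b) : |a - b| ≤ l := by
  have e0 := height_eq_of_point_eq h0
  have e1 := height_eq_of_point_eq h1
  have hs : l * Real.sin g'.v = (b - a) * Real.sin g.v := by linarith
  have hcs : X.cs (l * Real.cos g'.v) = X.cs ((a - b) * Real.cos g.v) := by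
    rw [sub_mul, ← form_shadow, ← shadow_eq_of_point_eq h0, ← shadow_eq_of_point_eq h1, form_shadow,
      zero_mul, zero_sub, cs_neg]
  have hle := hab.abs_le_of_cs_eq (mul_nonneg hl g'.cos_v_nonneg) hcs
  have hsq : ((a - b) * Real.cos g.v) ^ 2 ≤ (l * Real.cos g'.v) ^ 2 := by
    rw [← sq_abs]
    exact pow_le_pow_left₀ (abs_nonneg _) hle 2
  have hs2 : (l * Real.sin g'.v) ^ 2 = ((b - a) * Real.sin g.v) ^ 2 := by rw [hs]
  refine abs_le_of_sq_le_sq ?_ hl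
  have t := Real.sin_sq_add_cos_sq g.v
  have t' := Real.sin_sq_add_cos_sq g'.v
  linear_combination hsq - (a - b) ^ 2 * t + l ^ 2 * t' - hs2

lemma gdist_point (g : X.Geodesic) {a b : ℝ} (hab : X.SmallAngle ((a - b) * Real.cos g.v)) :
    X.gdist (g.point a) (g.point b) = |a - b| := by
  apply IsLeast.csInf_eq
  constructor
  · obtain ⟨g', -, ε, -, hb, hg'⟩ := g.exists_reparam a b
    refine ⟨abs_nonneg _, g', by rw [hg', mul_zero, add_zero], ?_⟩
    rw [hg', abs_sub_comm, ← hb]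
  · rintro l ⟨hl, g', h0, h1⟩
    exact g.arc_le g' hab hl h0 h1

/-- The height difference over the common length `d` determines `sin v`, hence `v`; the end point
then determines the direction because `sn (d cos v) ≠ 0`. -/
lemma point_eq_of_endpoints_eq (g g' : X.Geodesic) {d : ℝ} (hd : 0 < d) (hc : Real.cos g.v ≠ 0)
    (hsmall : X.SmallAngle (d * Real.cos g.v)) (h0 : g'.point 0 = g.point 0)
    (h1 : g'.point d = g.point d) (s : ℝ) : g'.point s = g.point s := by
  have e0 := height_eq_of_point_eq h0
  have e1 := height_eq_of_point_eq h1
  have hh : g'.height = g.height := by linarith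
  have hs : Real.sin g'.v = Real.sin g.v := by
    apply mul_left_cancel₀ hd.ne'
    linarith
  have hv : g'.v = g.v := Real.injOn_sin g'.v_mem g.v_mem hs
  have s0 := shadow_eq_of_point_eq h0
  have s1 := shadow_eq_of_point_eq h1
  simp only [shadow, zero_mul, cs_zero, sn_zero, one_smul, zero_smul, add_zero] at s0
  simp only [shadow, s0, hv] at s1
  have hdir := smul_right_injective _ (hsmall.sn_ne_zero (mul_ne_zero hd.ne' hc))
    (add_left_cancel s1)
  simp only [point, hh, hv, s0, hdir]

/-- Injectivity is only local: a great circle of `S²` is closed. Two angles within `π` of a common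
one differ by less than a full turn. -/
lemma param_eq (g : X.Geodesic) {a s t : ℝ} (hc : Real.cos g.v ≠ 0)
    (hs : X.SmallAngle ((a - s) * Real.cos g.v)) (ht : X.SmallAngle ((a - t) * Real.cos g.v))
    (h : g.point s = g.point t) : s = t := by
  have h1 := g.form_shadow_self (t * Real.cos g.v)
  nth_rewrite 2 [← shadow_eq_of_point_eq h] at h1
  rw [form_shadow] at h1
  have := hs.eq_of_cs_sub_eq_one ht (by rw [← h1]; congr 1; ring)
  have := mul_right_cancel₀ hc this
  linarith

lemma point_mem_geodesicSegment_iff (g : X.Geodesic) {a p b : ℝ} (hc : Real.cos g.v ≠ 0)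
    (hap : X.SmallAngle ((a - p) * Real.cos g.v)) (hab : X.SmallAngle ((a - b) * Real.cos g.v))
    (hne : a ≠ b) :
    g.point p ∈ X.geodesicSegment (g.point a) (g.point b) ↔ 0 ≤ (p - a) * (b - p) := by
  have hd := g.gdist_point hab
  obtain ⟨g', hc', ε, hε, hb, hg'⟩ := g.exists_reparam a b
  rw [abs_sub_comm] at hb
  have hdpos : 0 < |a - b| := abs_pos.2 (sub_ne_zero.2 hne)
  have h0 : g'.point 0 = g.point a := by rw [hg', mul_zero, add_zero]
  have h1 : g'.point |a - b| = g.point b := by rw [hg', ← hb]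
  have hεabs : |ε| = 1 := by
    rcases mul_self_eq_one_iff.1 hε with h | h <;> simp [h]
  have key (s : ℝ) : (a + ε * s - a) * (b - (a + ε * s)) = s * (|a - b| - s) := by
    linear_combination ε * s * hb + s * (|a - b| - s) * hε
  simp only [geodesicSegment, Set.mem_ofPred_eq, hd]
  constructor
  · rintro ⟨k, hk0, hk1, s, ⟨hs0, hs1⟩, hk⟩
    rw [g'.point_eq_of_endpoints_eq k hdpos (hc' ▸ hc)
      (hab.mono (by rw [hc', abs_mul, abs_mul, abs_abs])) (hk0.trans h0.symm) (hk1.trans h1.symm),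
      hg'] at hk
    have hp : a + ε * s = p := by
      refine g.param_eq hc (hab.mono ?_) hap hk
      rw [abs_mul, abs_mul]
      refine mul_le_mul_of_nonneg_right ?_ (abs_nonneg _)
      rw [sub_add_cancel_left, abs_neg, abs_mul, hεabs, one_mul, abs_of_nonneg hs0]
      exact hs1
    rw [← hp, key]
    exact mul_nonneg hs0 (sub_nonneg.2 hs1)
  · intro h
    have hp : a + ε * (ε * (p - a)) = p := by linear_combination (p - a) * hε
    rw [← hp, key] at h
    -- With `d = |a - b| > 0`, the inequality `0 ≤ s (d - s)` forces `0 ≤ s ≤ d`.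
    refine ⟨g', h0, h1, ε * (p - a), ⟨?_, ?_⟩, by rw [hg', hp]⟩ <;> nlinarith

end Geodesic

/-! ### The simple ratio as a quotient of coefficients -/

/-- Since `sn` is odd, removing the absolute values costs exactly the sign in the definition of the
simple ratio. -/
lemma sn_abs_mul_div (X : ProductGeometry) (x y c : ℝ) :
    X.sn (|x| * c) / X.sn (|y| * c) = if 0 ≤ x * y then X.sn (x * c) / X.sn (y * c)
      else -(X.sn (x * c) / X.sn (y * c)) := by
  rcases lt_trichotomy x 0 with hx | rfl | hx
  · rcases lt_trichotomy y 0 with hy | rfl | hy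
    · rw [if_pos (mul_nonneg_of_nonpos_of_nonpos hx.le hy.le), abs_of_neg hx, abs_of_neg hy]
      simp [sn_neg]
    · simp [sn_zero]
    · rw [if_neg (not_le.2 (mul_neg_of_neg_of_pos hx hy)), abs_of_neg hx, abs_of_pos hy]
      simp [sn_neg, neg_div]
  · simp [sn_zero]
  · rcases lt_trichotomy y 0 with hy | rfl | hy
    · rw [if_neg (not_le.2 (mul_neg_of_pos_of_neg hx hy)), abs_of_pos hx, abs_of_neg hy]
      simp [sn_neg, div_neg]
    · simp [sn_zero]
    · rw [if_pos (mul_nonneg hx.le hy.le), abs_of_pos hx, abs_of_pos hy]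

lemma ShortArc.smallAngle {g : X.Geodesic} {a b : ℝ} (h : X.ShortArc g a b) :
    X.SmallAngle ((a - b) * Real.cos g.v) := by
  cases X
  · simpa [SmallAngle, ShortArc, abs_mul, abs_of_nonneg g.cos_v_nonneg] using h
  · trivial

/-- The projection of a point to the base plane along its fibre. -/
noncomputable def toBase (X : ProductGeometry) (A : Fin 3 → ℝ) : Fin 3 → ℝ :=
  (√(X.form A A))⁻¹ • A

lemma Geodesic.toBase_point (g : X.Geodesic) (t : ℝ) :
    X.toBase (g.point t) = g.shadow (t * Real.cos g.v) := by
  rw [toBase, sqrt_form_point, point_eq, inv_smul_smul₀ (Real.exp_ne_zero _)]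

/-- The linear relation between three vectors of a plane; its coefficients are the `2 × 2`
determinants of the vectors `(cs, sn)`. -/
lemma sn_smul_shadow (g : X.Geodesic) (a p b : ℝ) :
    X.sn (b - a) • g.shadow p = X.sn (b - p) • g.shadow a + X.sn (p - a) • g.shadow b := by
  ext i
  simp only [Geodesic.shadow, Pi.smul_apply, Pi.add_apply, smul_eq_mul, sn_sub]
  ring

/-- The simple ratio is the ratio of the coefficients of the point with respect to the projections
of the end points to the base plane. -/
lemma HasSimpleRatio.exists_coefficients {g : X.Geodesic} {A P B : Fin 3 → ℝ}
    (h : X.HasSimpleRatio g A P B) :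
    ∃ k x y : ℝ, x ≠ 0 ∧ y ≠ 0 ∧ k • P = x • X.toBase A + y • X.toBase B ∧
      X.simpleRatio g A P B = y / x := by
  obtain ⟨hc, hAP, hPB, hAB, a, p, b, rfl, rfl, rfl, sap, spb, sab⟩ := h
  have hap : a ≠ p := fun e => hAP (e ▸ rfl)
  have hpb : p ≠ b := fun e => hPB (e ▸ rfl)
  have hab : a ≠ b := fun e => hAB (e ▸ rfl)
  have hx : X.sn ((b - p) * Real.cos g.v) ≠ 0 :=
    (spb.smallAngle.mono (by rw [abs_mul, abs_mul, abs_sub_comm])).sn_ne_zero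
      (mul_ne_zero (sub_ne_zero.2 hpb.symm) hc)
  have hy : X.sn ((p - a) * Real.cos g.v) ≠ 0 :=
    (sap.smallAngle.mono (by rw [abs_mul, abs_mul, abs_sub_comm])).sn_ne_zero
      (mul_ne_zero (sub_ne_zero.2 hap.symm) hc)
  -- The second factor of `k` projects `P` to the base plane, where `sn_smul_shadow` applies.
  refine ⟨X.sn ((b - a) * Real.cos g.v) * (√(X.form (g.point p) (g.point p)))⁻¹, _, _, hx, hy,
    ?_, ?_⟩
  · rw [mul_smul, ← toBase, g.toBase_point, g.toBase_point, g.toBase_point, sub_mul, sub_mul,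
      sub_mul]
    exact sn_smul_shadow g _ _ _
  · rw [simpleRatio, g.gdist_point sap.smallAngle, g.gdist_point spb.smallAngle, abs_sub_comm a p,
      abs_sub_comm p b, sn_abs_mul_div]
    simp only [g.point_mem_geodesicSegment_iff hc sap.smallAngle sab.smallAngle hab]
    split_ifs <;> simp

/-! ### Coplanarity with the centre -/

/-- The determinant of three vectors. -/
def det₃ (x y z : Fin 3 → ℝ) : ℝ := Matrix.det (Matrix.of ![x, y, z])

lemma det₃_eq (x y z : Fin 3 → ℝ) :
    det₃ x y z = x 0 * y 1 * z 2 - x 0 * y 2 * z 1 - x 1 * y 0 * z 2 + x 1 * y 2 * z 0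
      + x 2 * y 0 * z 1 - x 2 * y 1 * z 0 := by
  simp [det₃, Matrix.det_fin_three]

lemma GeneralLocation.det₃_ne_zero {A₀ A₁ A₂ : Fin 3 → ℝ} (h : GeneralLocation A₀ A₁ A₂) :
    det₃ A₀ A₁ A₂ ≠ 0 := by
  intro h0
  obtain ⟨n, hn, hM⟩ := Matrix.exists_mulVec_eq_zero_iff.2 h0
  refine h ⟨n, hn, ?_, ?_, ?_⟩ <;> rw [dotProduct_comm]
  · exact congrFun hM 0
  · exact congrFun hM 1
  · exact congrFun hM 2

lemma det₃_smul (a b c : ℝ) (x y z : Fin 3 → ℝ) :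
    det₃ (a • x) (b • y) (c • z) = a * b * c * det₃ x y z := by
  simp only [det₃_eq, Pi.smul_apply, smul_eq_mul]; ring

lemma det₃_shadow (g : X.Geodesic) (a b c : ℝ) :
    det₃ (g.shadow a) (g.shadow b) (g.shadow c) = 0 := by
  simp only [det₃_eq, Geodesic.shadow, Pi.add_apply, Pi.smul_apply, smul_eq_mul]; ring

/-- A point of a connecting curve lies in a plane through the centre and the two given points. -/
lemma det₃_eq_zero_of_mem_connectingCurve {S : Set (Fin 3 → ℝ)} {A T Q : Fin 3 → ℝ}
    (h : Q ∈ X.connectingCurve S A T) : det₃ A T Q = 0 := by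
  obtain ⟨-, g, ⟨a, rfl⟩, ⟨b, rfl⟩, τ, c, -, rfl⟩ := h
  rw [g.point_eq, g.point_eq, g.point_eq, smul_smul, det₃_smul, det₃_shadow, mul_zero]

lemma ne_zero_of_mem_connectingCurve {S : Set (Fin 3 → ℝ)} {A T Q : Fin 3 → ℝ}
    (h : Q ∈ X.connectingCurve S A T) : T ≠ 0 := by
  obtain ⟨-, g, -, ⟨b, rfl⟩, -⟩ := h
  exact g.point_ne_zero b

lemma det₃_smul_left (a : ℝ) (x y z : Fin 3 → ℝ) : det₃ (a • x) y z = a * det₃ x y z := by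
  simpa using det₃_smul a 1 1 x y z

lemma det₃_smul_right (c : ℝ) (x y z : Fin 3 → ℝ) : det₃ x y (c • z) = c * det₃ x y z := by
  simpa using det₃_smul 1 1 c x y z

lemma det₃_combination (x y u v : Fin 3 → ℝ) (a b : ℝ) :
    det₃ x y (a • u + b • v) = a * det₃ x y u + b * det₃ x y v := by
  simp only [det₃_eq, Pi.add_apply, Pi.smul_apply, smul_eq_mul]; ring

/-- Cramer's rule. -/
lemma det₃_smul_eq (u v w t : Fin 3 → ℝ) :
    det₃ u v w • t = det₃ t v w • u + det₃ u t w • v + det₃ u v t • w := by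
  ext i
  fin_cases i <;> simp [det₃_eq] <;> ring

/-- Ceva's theorem for cones: if the planes through the vertices and `t` meet the opposite faces in
`x₀ u + y₀ v`, `x₁ v + y₁ w`, `x₂ w + y₂ u`, then the product of the ratios is `1`. -/
lemma ceva_of_det₃ {u v w t : Fin 3 → ℝ} (h : det₃ u v w ≠ 0) (ht : t ≠ 0)
    {x₀ y₀ x₁ y₁ x₂ y₂ : ℝ} (hx₀ : x₀ ≠ 0) (hy₀ : y₀ ≠ 0) (hx₁ : x₁ ≠ 0) (hy₁ : y₁ ≠ 0)
    (hx₂ : x₂ ≠ 0) (hy₂ : y₂ ≠ 0)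
    (h₀ : det₃ w t (x₀ • u + y₀ • v) = 0) (h₁ : det₃ u t (x₁ • v + y₁ • w) = 0)
    (h₂ : det₃ v t (x₂ • w + y₂ • u) = 0) : y₀ / x₀ * (y₁ / x₁) * (y₂ / x₂) = 1 := by
  have cramer := det₃_smul_eq u v w t
  rw [det₃_combination] at h₀ h₁ h₂
  -- The three determinants are the coordinates of `t` in the basis `u, v, w`, up to the factor
  -- `det₃ u v w`; each plane fixes the ratio of two of them.
  have e₀ : x₀ * det₃ u t w = y₀ * det₃ t v w := by
    simp only [det₃_eq] at h₀ ⊢; linear_combination -h₀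
  have e₁ : x₁ * det₃ u v t = y₁ * det₃ u t w := by
    simp only [det₃_eq] at h₁ ⊢; linear_combination -h₁
  have e₂ : x₂ * det₃ t v w = y₂ * det₃ u v t := by
    simp only [det₃_eq] at h₂ ⊢; linear_combination -h₂
  generalize det₃ t v w = α at *
  generalize det₃ u t w = β at *
  generalize det₃ u v t = γ at *
  -- If one coordinate vanished, all would, and Cramer's rule would give `t = 0`.
  have hα0 : α ≠ 0 := by
    intro hα0
    have hβ0 : β = 0 := by simpa [hα0, hx₀] using e₀
    have hγ0 : γ = 0 := by simpa [hβ0, hx₁] using e₁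
    rw [hα0, hβ0, hγ0] at cramer
    exact smul_ne_zero h ht (by simpa using cramer)
  have hβ0 : β ≠ 0 := fun h0 => mul_ne_zero hy₀ hα0 (by rw [← e₀, h0, mul_zero])
  have hγ0 : γ ≠ 0 := fun h0 => mul_ne_zero hy₁ hβ0 (by rw [← e₁, h0, mul_zero])
  have r₀ : y₀ / x₀ = β / α := by rw [div_eq_div_iff hx₀ hα0, ← e₀, mul_comm]
  have r₁ : y₁ / x₁ = γ / β := by rw [div_eq_div_iff hx₁ hβ0, ← e₁, mul_comm]
  have r₂ : y₂ / x₂ = α / γ := by rw [div_eq_div_iff hx₂ hγ0, ← e₂, mul_comm]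
  rw [r₀, r₁, r₂]
  field_simp

lemma HasSimpleRatio.sqrt_form_ne_zero {g : X.Geodesic} {A P B : Fin 3 → ℝ}
    (h : X.HasSimpleRatio g A P B) : √(X.form A A) ≠ 0 := by
  obtain ⟨-, -, -, -, a, -, -, rfl, -⟩ := h
  rw [g.sqrt_form_point]
  exact Real.exp_ne_zero _

lemma det₃_toBase_eq_zero {A T Q V : Fin 3 → ℝ} {k : ℝ} (hk : k • Q = V) (h : det₃ A T Q = 0) :
    det₃ (X.toBase A) T V = 0 := by
  rw [← hk, toBase, det₃_smul_left, det₃_smul_right, h, mul_zero, mul_zero]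

end ProductGeometry

theorem theorem4p7 (X : ProductGeometry) (A₀ A₁ A₂ T P Q R : Fin 3 → ℝ)
    (hA₀ : A₀ ∈ X.space) (hA₁ : A₁ ∈ X.space) (hA₂ : A₂ ∈ X.space)
    (hA : ProductGeometry.GeneralLocation A₀ A₁ A₂)
    (hT : T ∈ X.triangleSurface A₀ A₁ A₂)
    (hT₀₁ : T ∉ X.geodesicSegment A₀ A₁)
    (hT₁₂ : T ∉ X.geodesicSegment A₁ A₂)
    (hT₂₀ : T ∉ X.geodesicSegment A₂ A₀)
    (g₀₁ g₁₂ g₂₀ : X.Geodesic)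
    (hP : X.HasSimpleRatio g₀₁ A₀ P A₁)
    (hQ : X.HasSimpleRatio g₁₂ A₁ Q A₂)
    (hR : X.HasSimpleRatio g₂₀ A₂ R A₀)
    (hQT : Q ∈ X.connectingCurve (X.triangleSurface A₀ A₁ A₂) A₀ T)
    (hRT : R ∈ X.connectingCurve (X.triangleSurface A₀ A₁ A₂) A₁ T)
    (hPT : P ∈ X.connectingCurve (X.triangleSurface A₀ A₁ A₂) A₂ T) :
    X.simpleRatio g₀₁ A₀ P A₁ * X.simpleRatio g₁₂ A₁ Q A₂ * X.simpleRatio g₂₀ A₂ R A₀ = 1 := by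
  obtain ⟨k₀, x₀, y₀, hx₀, hy₀, hk₀, e₀⟩ := hP.exists_coefficients
  obtain ⟨k₁, x₁, y₁, hx₁, hy₁, hk₁, e₁⟩ := hQ.exists_coefficients
  obtain ⟨k₂, x₂, y₂, hx₂, hy₂, hk₂, e₂⟩ := hR.exists_coefficients
  rw [e₀, e₁, e₂]
  refine ProductGeometry.ceva_of_det₃ (t := T) ?_
    (ProductGeometry.ne_zero_of_mem_connectingCurve hQT) hx₀ hy₀ hx₁ hy₁ hx₂ hy₂
    (ProductGeometry.det₃_toBase_eq_zero hk₀
      (ProductGeometry.det₃_eq_zero_of_mem_connectingCurve hPT))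
    (ProductGeometry.det₃_toBase_eq_zero hk₁
      (ProductGeometry.det₃_eq_zero_of_mem_connectingCurve hQT))
    (ProductGeometry.det₃_toBase_eq_zero hk₂
      (ProductGeometry.det₃_eq_zero_of_mem_connectingCurve hRT))
  rw [ProductGeometry.toBase, ProductGeometry.toBase, ProductGeometry.toBase,
    ProductGeometry.det₃_smul]
  exact mul_ne_zero (mul_ne_zero (mul_ne_zero (inv_ne_zero hP.sqrt_form_ne_zero)
    (inv_ne_zero hQ.sqrt_form_ne_zero)) (inv_ne_zero hR.sqrt_form_ne_zero)) hA.det₃_ne_zero
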